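/- Let $A\in\mathbb R^{m\times n}$ (a linear map $\mathbb R^n\to\mathbb R^m$ with adjoint $A^*$), $b\in\mathbb R^m$, $c\in\mathbb R^n$, and let $K=\{x\in\mathbb R^n : l\le x\le u\}$ be a nonempty box, where components of $l$ and $u$ may be infinite. Let $\Pi_K$ be the Euclidean projector onto $K$ and $\partial\Pi_K$ its Clarke generalized Jacobian. Given $\tilde x\in\mathbb R^n$, $\tilde y\in\mathbb R^m$ and $\sigma,\tau>0$, let $$\psi(y)=L_\sigma(y;\tilde x)+\frac{\tau}{2\sigma}\|y-\tilde y\|^2,\qquad L_\sigma(y;x)=\sup_{s\in K}\Big\{-\langle b,y\rangle-\langle s,c-A^*y\rangle-\frac1{2\sigma}\|s-x\|^2\Big\}.$$ Algorithm SSN. Choose $\bar\eta\in(0,1)$, $\gamma\in(0,1]$, $\mu\in(0,1/2)$, $\delta\in(0,1)$ and set $y^0=\tilde y$. For $j=0,1,2,\dots$: 1. Choose $U_j\in\partial\Pi_K(\tilde x+\sigma(A^*y^j-c))$ and set $H_j=\tau\sigma^{-1}I_m+\sigma AU_jA^*$. Solve $H_jd=-\nabla\psi(y^j)$ exactly or by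 a Krylov iterative method to find $d^j$ with $\|H_jd^j+\nabla\psi(y^j)\|\le\min(\bar\eta,\|\nabla\psi(y^j)\|^{1+\gamma})$. Here "by a Krylov iterative method" means that $d^j$ is an iterate of the conjugate gradient method or of the minimum residual method (MINRES) started from $0$, possibly with a symmetric positive definite preconditioner (the method, the preconditioner and the number of inner iterations may vary with $j$). 2. Set $\alpha_j=\delta^{m_j}$, where $m_j$ is the first nonnegative integer $k$ for which $\psi(y^j+\delta^kd^j)\le\psi(y^j)+\mu\delta^k\langle\nabla\psi(y^j),d^j\rangle$. 3. Set $y^{j+1}=y^j+\alpha_jd^j$. Theorem. Let $\{y^j\}_{j\ge0}$ be any infinite sequence generated by Algorithm SSN. Then $\psi$ has a unique minimizer $\bar y$ over $\mathbb R^m$, the sequence $\{y^j\}$ converges to $\bar y$, and $$\|y^{j+1}-\bar y\|=O\big(\|y^j-\bar y\|^{1+\gamma}\big)\qquad(j\to\infty).$$ -/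

import Mathlib

open Filter Topology
open scoped Gradient

/-- The Euclidean projector `Π_D(x) = argmin {‖x - d‖ ∣ d ∈ D}`. -/
noncomputable def euclideanProj {E : Type*} [NormedAddCommGroup E] (D : Set E) (x : E) : E :=
  Classical.epsilon fun d => d ∈ D ∧ ∀ d' ∈ D, ‖x - d‖ ≤ ‖x - d'‖

/-- On a nonempty closed set the projector is a genuine nearest point. -/
theorem euclideanProj_spec {E : Type*} [NormedAddCommGroup E] [ProperSpace E] {D : Set E}
    (hne : D.Nonempty) (hcl : IsClosed D) (x : E) :
    euclideanProj D x ∈ D ∧ ∀ d' ∈ D, ‖x - euclideanProj D x‖ ≤ ‖x - d'‖ := by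
  have h : ∃ d, d ∈ D ∧ ∀ d' ∈ D, ‖x - d‖ ≤ ‖x - d'‖ := by
    obtain ⟨d, hd, hdist⟩ := hcl.exists_infDist_eq_dist hne x
    refine ⟨d, hd, fun d' hd' => ?_⟩
    rw [← dist_eq_norm, ← dist_eq_norm, ← hdist]
    exact Metric.infDist_le_dist_of_mem hd'
  exact Classical.epsilon_spec h

/-- The Clarke generalized Jacobian of `F` at `x`: the convex hull of all limits of derivatives of
`F` along sequences of differentiability points converging to `x`. -/
def clarkeJacobian {E G : Type*} [NormedAddCommGroup E] [NormedSpace ℝ E]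
    [NormedAddCommGroup G] [NormedSpace ℝ G] (F : E → G) (x : E) : Set (E →L[ℝ] G) :=
  convexHull ℝ {V | ∃ z : ℕ → E, Tendsto z atTop (𝓝 x) ∧
    (∀ k, DifferentiableAt ℝ F (z k)) ∧ Tendsto (fun k => fderiv ℝ F (z k)) atTop (𝓝 V)}

section Krylov

variable {E : Type*} [NormedAddCommGroup E] [InnerProductSpace ℝ E]

/-- Symmetric positive definite operators. -/
def IsSPD (P : E →L[ℝ] E) : Prop :=
  (∀ v w, inner ℝ (P v) w = inner ℝ v (P w)) ∧ ∀ v, v ≠ 0 → 0 < inner ℝ v (P v)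

/-- The Krylov subspace `span {v, T v, …, T^(k-1) v}`. -/
def krylovSubspace (T : E →L[ℝ] E) (v : E) (k : ℕ) : Submodule ℝ E :=
  Submodule.span ℝ {w | ∃ i < k, w = (T ^ i) v}

/-- `d` is the `k`-th iterate, started from `0`, of the conjugate gradient method for `H d = r`
with preconditioner `P⁻¹`: it minimizes the energy `½⟨v, H v⟩ - ⟨r, v⟩` (equivalently the
`H`-norm of the error) over the Krylov subspace of `P H` and `P r`. -/
def IsPCGIterate (H P : E →L[ℝ] E) (r : E) (k : ℕ) (d : E) : Prop :=
  d ∈ krylovSubspace (P.comp H) (P r) k ∧ ∀ v ∈ krylovSubspace (P.comp H) (P r) k,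
    (1 / 2 : ℝ) * inner ℝ d (H d) - inner ℝ r d ≤ (1 / 2 : ℝ) * inner ℝ v (H v) - inner ℝ r v

/-- `d` is the `k`-th iterate, started from `0`, of the minimum residual method for `H d = r`
with preconditioner `P⁻¹`: it minimizes the residual, in the norm induced by `P`, over the
Krylov subspace of `P H` and `P r`. -/
def IsMINRESIterate (H P : E →L[ℝ] E) (r : E) (k : ℕ) (d : E) : Prop :=
  d ∈ krylovSubspace (P.comp H) (P r) k ∧ ∀ v ∈ krylovSubspace (P.comp H) (P r) k,
    inner ℝ (r - H d) (P (r - H d)) ≤ inner ℝ (r - H v) (P (r - H v))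

/-- `d` is obtained from the linear system `H d = r` exactly, or as some iterate of a
(possibly preconditioned) Krylov method, CG or MINRES, started from `0`. -/
def IsExactOrKrylov (H : E →L[ℝ] E) (r d : E) : Prop :=
  H d = r ∨ ∃ P : E →L[ℝ] E, IsSPD P ∧
    ∃ k : ℕ, IsPCGIterate H P r k d ∨ IsMINRESIterate H P r k d

end Krylov

/-- Data of the proximal augmented Lagrangian subproblem: the linear program
`min {⟨c, x⟩ ∣ A x = b, l ≤ x ≤ u}` (infinite bounds allowed), the centres `xt`, `yt`, and the
parameters `σ`, `τ`. -/
structure PALData (n m : ℕ) where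
  A : EuclideanSpace ℝ (Fin n) →L[ℝ] EuclideanSpace ℝ (Fin m)
  b : EuclideanSpace ℝ (Fin m)
  c : EuclideanSpace ℝ (Fin n)
  l : Fin n → EReal
  u : Fin n → EReal
  xt : EuclideanSpace ℝ (Fin n)
  yt : EuclideanSpace ℝ (Fin m)
  σ : ℝ
  τ : ℝ

namespace PALData

variable {n m : ℕ} (D : PALData n m)

/-- The box `K = {x ∣ l ≤ x ≤ u}`. -/
def K : Set (EuclideanSpace ℝ (Fin n)) :=
  {x | ∀ i, D.l i ≤ (x i : EReal) ∧ (x i : EReal) ≤ D.u i}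

/-- `A*`. -/
noncomputable def At : EuclideanSpace ℝ (Fin m) →L[ℝ] EuclideanSpace ℝ (Fin n) :=
  ContinuousLinearMap.adjoint D.A

/-- The Lagrangian `l(y; s) = -⟨b, y⟩ - ⟨s, c - A* y⟩` for `s ∈ K` (it is `-∞` for `s ∉ K`). -/
noncomputable def lagrangian (y : EuclideanSpace ℝ (Fin m)) (s : EuclideanSpace ℝ (Fin n)) : ℝ :=
  -inner ℝ D.b y - inner ℝ s (D.c - D.At y)

/-- The augmented Lagrangian `L_σ(y; x) = sup_s {l(y; s) - ‖s - x‖² / (2σ)}`; the points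
`s ∉ K`, where `l(y; s) = -∞`, do not contribute. -/
noncomputable def augLagrangian (y : EuclideanSpace ℝ (Fin m)) (x : EuclideanSpace ℝ (Fin n)) :
    ℝ :=
  ⨆ s : D.K, (D.lagrangian y s - 1 / (2 * D.σ) * ‖(s : EuclideanSpace ℝ (Fin n)) - x‖ ^ 2)

/-- The supremum in `augLagrangian` is finite. -/
theorem augLagrangian_bddAbove (hσ : 0 < D.σ) (y : EuclideanSpace ℝ (Fin m))
    (x : EuclideanSpace ℝ (Fin n)) :
    BddAbove (Set.range fun s : D.K =>
      D.lagrangian y s - 1 / (2 * D.σ) * ‖(s : EuclideanSpace ℝ (Fin n)) - x‖ ^ 2) := by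
  set w := D.c - D.At y with hw
  refine ⟨-inner ℝ D.b y - inner ℝ x w + D.σ / 2 * ‖w‖ ^ 2, ?_⟩
  rintro _ ⟨s, rfl⟩
  have h1 : inner ℝ (s : EuclideanSpace ℝ (Fin n)) w
      = inner ℝ ((s : EuclideanSpace ℝ (Fin n)) - x) w + inner ℝ x w := by
    rw [inner_sub_left]; ring
  have h2 := abs_le.1 (abs_real_inner_le_norm ((s : EuclideanSpace ℝ (Fin n)) - x) w)
  simp only [lagrangian, ← hw, h1]
  set t := ‖(s : EuclideanSpace ℝ (Fin n)) - x‖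
  have h3 : t * ‖w‖ ≤ 1 / (2 * D.σ) * t ^ 2 + D.σ / 2 * ‖w‖ ^ 2 := by
    have : 1 / (2 * D.σ) * t ^ 2 + D.σ / 2 * ‖w‖ ^ 2 - t * ‖w‖
        = (t - D.σ * ‖w‖) ^ 2 / (2 * D.σ) := by field_simp; ring
    have : 0 ≤ (t - D.σ * ‖w‖) ^ 2 / (2 * D.σ) := by positivity
    linarith
  linarith [h2.1]

/-- The objective `ψ(y) = L_σ(y; xt) + τ/(2σ) ‖y - yt‖²`. -/
noncomputable def ψ (y : EuclideanSpace ℝ (Fin m)) : ℝ :=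
  D.augLagrangian y D.xt + D.τ / (2 * D.σ) * ‖y - D.yt‖ ^ 2

/-- The Clarke Jacobian `∂Π_K(xt + σ (A* y - c))`. -/
def projJacobian (y : EuclideanSpace ℝ (Fin m)) :
    Set (EuclideanSpace ℝ (Fin n) →L[ℝ] EuclideanSpace ℝ (Fin n)) :=
  clarkeJacobian (euclideanProj D.K) (D.xt + D.σ • (D.At y - D.c))

/-- The generalized Hessian `H = τ σ⁻¹ I + σ A U A*`. -/
noncomputable def genHessian (U : EuclideanSpace ℝ (Fin n) →L[ℝ] EuclideanSpace ℝ (Fin n)) :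
    EuclideanSpace ℝ (Fin m) →L[ℝ] EuclideanSpace ℝ (Fin m) :=
  (D.τ * D.σ⁻¹) • ContinuousLinearMap.id ℝ (EuclideanSpace ℝ (Fin m))
    + D.σ • (D.A.comp (U.comp D.At))

/-- `y` is an infinite sequence generated by the inexact semismooth Newton method with Armijo line
search, with parameters `η` (tolerance), `γ`, `μ` (Armijo constant) and `δ` (backtracking). -/
def IsSsnSequence (η γ μ δ : ℝ) (y : ℕ → EuclideanSpace ℝ (Fin m)) : Prop :=
  y 0 = D.yt ∧ ∀ j, ∃ U ∈ D.projJacobian (y j), ∃ (d : EuclideanSpace ℝ (Fin m)) (mj : ℕ),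
    IsExactOrKrylov (D.genHessian U) (-∇ D.ψ (y j)) d ∧
    ‖D.genHessian U d + ∇ D.ψ (y j)‖ ≤ min η (‖∇ D.ψ (y j)‖ ^ (1 + γ)) ∧
    IsLeast {k : ℕ | D.ψ (y j + δ ^ k • d)
      ≤ D.ψ (y j) + μ * δ ^ k * inner ℝ (∇ D.ψ (y j)) d} mj ∧
    y (j + 1) = y j + δ ^ mj • d

end PALData

/-! The function `ψ` is a supremum of functions affine in `y` plus a proximal quadratic, so it is
strongly convex with modulus `κ = τ/σ`. The supremum is attained at a projection onto `K`, so the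
gradient is Lipschitz with constant `L = τ/σ + σ‖A‖²`.

Global convergence needs every inexact direction to be a uniform descent direction. This follows
from `⟨d, H d⟩ ≤ ⟨r, d⟩` (`IsExactOrKrylov.inner_map_self_le`): for CG it is stationarity along the
ray through `d`, for MINRES it is the trace argument of `IsMINRESIterate.inner_residual_nonneg`. The
residual test is a relative one with a factor below one (`exists_forcing_factor`), so `‖d‖` is at
least a multiple of the gradient norm. Armijo steps are bounded below, and the decrease of `ψ`
forces the gradients to zero.

The fast rate rests on the projector onto a box being a coordinatewise piecewise linear clamp. Near
the minimizer every element of the Clarke Jacobian therefore reproduces the gradient increment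
exactly, and `ψ` obeys the trapezoidal rule exactly (`PALData.exact_near`). The error after a full
step is then controlled by the linear residual alone, and the factor `1/2` of the trapezoidal rule,
against `μ < 1/2`, makes the line search accept the full step eventually. -/

/-! ### Krylov iterates of positive definite systems -/

theorem krylovSubspace_mono {E : Type*} [NormedAddCommGroup E] [InnerProductSpace ℝ E]
    (T : E →L[ℝ] E) (v : E) {k l : ℕ} (h : k ≤ l) :
    krylovSubspace T v k ≤ krylovSubspace T v l :=
  Submodule.span_mono fun _ ⟨i, hi, hw⟩ => ⟨i, hi.trans_le h, hw⟩

theorem krylovSubspace_eq_span_range {E : Type*} [NormedAddCommGroup E] [InnerProductSpace ℝ E]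
    (T : E →L[ℝ] E) (v : E) (k : ℕ) :
    krylovSubspace T v k = Submodule.span ℝ (Set.range fun i : Fin k => (T ^ (i : ℕ)) v) := by
  unfold krylovSubspace
  congr 1
  ext w
  constructor
  · rintro ⟨i, hi, rfl⟩
    exact ⟨⟨i, hi⟩, rfl⟩
  · rintro ⟨i, rfl⟩
    exact ⟨i, i.2, rfl⟩

/-- Either the Krylov vectors are linearly independent, or the Krylov subspace already contains a
solution of the linear system. -/
theorem linearIndependent_krylov_or_exists_solution {E : Type*} [NormedAddCommGroup E]
    [InnerProductSpace ℝ E] (T : E →L[ℝ] E) (hT : Function.Injective T) (v : E) (k : ℕ) :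
    LinearIndependent ℝ (fun i : Fin k => (T ^ (i : ℕ)) v) ∨
      ∃ s ∈ krylovSubspace T v k, T s = v := by
  induction k with
  | zero => exact Or.inl linearIndependent_empty_type
  | succ k ih =>
    rcases ih with ih | ⟨s, hs, hTs⟩
    · have hcons : (fun i : Fin (k + 1) => (T ^ (i : ℕ)) v)
          = Fin.cons v (fun i : Fin k => T ((T ^ (i : ℕ)) v)) := by
        funext i
        refine Fin.cases ?_ (fun i => ?_) i
        · simp
        · simp [pow_succ']
      rw [hcons, linearIndependent_finCons]
      -- The first vector is split off, not the last: the others are `T` applied to an independent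
      -- family, so any dependence writes `v` as `T s`.
      by_cases hv : v ∈ Submodule.span ℝ (Set.range fun i : Fin k => T ((T ^ (i : ℕ)) v))
      · right
        have hr : (Set.range fun i : Fin k => T ((T ^ (i : ℕ)) v))
            = (T : E →ₗ[ℝ] E) '' Set.range (fun i : Fin k => (T ^ (i : ℕ)) v) := by
          rw [← Set.range_comp]; rfl
        rw [hr, Submodule.span_image, ← krylovSubspace_eq_span_range] at hv
        obtain ⟨s, hs, hTs⟩ := hv
        exact ⟨s, krylovSubspace_mono T v k.le_succ hs, hTs⟩
      · left
        exact ⟨ih.map' (T : E →ₗ[ℝ] E) (LinearMap.ker_eq_bot.2 hT), hv⟩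
    · exact Or.inr ⟨s, krylovSubspace_mono T v k.le_succ hs, hTs⟩

/-- If `G M = N` with `G` positive definite and `N` positive semidefinite, then `M` has
nonnegative trace. -/
theorem Matrix.trace_nonneg_of_posDef_mul_eq {ι : Type*} [Fintype ι] [DecidableEq ι]
    {G M N : Matrix ι ι ℝ} (hG : G.PosDef) (hN : N.PosSemidef) (h : G * M = N) :
    0 ≤ M.trace := by
  obtain ⟨B, rfl⟩ : ∃ B : Matrix ι ι ℝ, N = B.conjTranspose * B := by
    open scoped MatrixOrder Matrix.Norms.L2Operator in
    exact CStarAlgebra.nonneg_iff_eq_star_mul_self.mp hN.nonneg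
  have hM : M = G⁻¹ * (B.conjTranspose * B) := by
    rw [← h, ← Matrix.mul_assoc,
      Matrix.nonsing_inv_mul _ ((Matrix.isUnit_iff_isUnit_det _).1 hG.isUnit), Matrix.one_mul]
  -- Cyclicity of the trace replaces `G⁻¹ Bᴴ B` by the positive semidefinite `B G⁻¹ Bᴴ`.
  rw [hM, ← Matrix.mul_assoc, Matrix.trace_mul_comm, ← Matrix.mul_assoc]
  exact (hG.inv.posSemidef.mul_mul_conjTranspose_same B).trace_nonneg

/-- The discriminant of the quadratic is `β²`. This is the first-order optimality condition for both
Krylov methods. -/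
theorem eq_zero_of_forall_nonneg_linear_add_sq {α β : ℝ}
    (h : ∀ s : ℝ, 0 ≤ α * (s * s) + β * s) : β = 0 := by
  have h1 := discrim_le_zero (a := α) (b := β) (c := 0) (fun s => by simpa using h s)
  simp only [discrim] at h1
  nlinarith

section Krylov

variable {E : Type*} [NormedAddCommGroup E] [InnerProductSpace ℝ E]

theorem IsSPD.injective {P : E →L[ℝ] E} (hP : IsSPD P) : Function.Injective P := by
  rw [injective_iff_map_eq_zero]
  intro v hv
  by_contra hne
  have := hP.2 v hne
  simp [hv] at this

theorem IsSPD.inner_nonneg {P : E →L[ℝ] E} (hP : IsSPD P) (v : E) : 0 ≤ inner ℝ v (P v) := by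
  by_cases hv : v = 0
  · simp [hv]
  · exact (hP.2 v hv).le

/-- The ray through `d` stays in the Krylov subspace, so the energy is stationary along it. -/
theorem IsPCGIterate.inner_map_self {H P : E →L[ℝ] E} {r d : E} {k : ℕ}
    (h : IsPCGIterate H P r k d) : inner ℝ d (H d) = inner ℝ r d := by
  have h1 : inner ℝ d (H d) - inner ℝ r d = 0 := by
    refine eq_zero_of_forall_nonneg_linear_add_sq (α := (1 / 2 : ℝ) * inner ℝ d (H d)) fun s => ?_
    have := h.2 ((1 + s) • d) (Submodule.smul_mem _ _ h.1)
    simp only [map_smul, real_inner_smul_left, real_inner_smul_right] at this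
    linarith
  linarith

/-- Normal equations of the least-squares problem: the first variation of the residual norm in the
direction `v` vanishes. -/
theorem IsMINRESIterate.residual_orthogonal {H P : E →L[ℝ] E} (hP : IsSPD P) {r d : E} {k : ℕ}
    (h : IsMINRESIterate H P r k d) {v : E} (hv : v ∈ krylovSubspace (P.comp H) (P r) k) :
    inner ℝ (H v) (P (r - H d)) = 0 := by
  have h1 : -2 * inner ℝ (H v) (P (r - H d)) = 0 := by
    refine eq_zero_of_forall_nonneg_linear_add_sq (α := inner ℝ (H v) (P (H v))) fun s => ?_
    have h2 := h.2 (d + s • v) (Submodule.add_mem _ h.1 (Submodule.smul_mem _ _ hv))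
    have h3 : r - H (d + s • v) = (r - H d) - s • H v := by
      rw [map_add, map_smul]; abel
    rw [h3] at h2
    generalize r - H d = ρ at *
    have h4 : inner ℝ ρ (P (H v)) = inner ℝ (H v) (P ρ) := by
      rw [← hP.1, real_inner_comm]
    simp only [map_sub, map_smul, inner_sub_left, inner_sub_right, real_inner_smul_left,
      real_inner_smul_right, h4] at h2
    linarith
  linarith

/-- The iterate and the residual of the minimum residual method for a symmetric positive definite
system enclose an acute angle. -/
theorem IsMINRESIterate.inner_residual_nonneg {H P : E →L[ℝ] E} (hH : IsSPD H) (hP : IsSPD P)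
    {r d : E} {k : ℕ} (h : IsMINRESIterate H P r k d) : 0 ≤ inner ℝ d (r - H d) := by
  set T := P.comp H with hT
  have hTinj : Function.Injective T := hP.injective.comp hH.injective
  -- If the Krylov subspace contains the exact solution, the minimal residual is zero; otherwise the
  -- Krylov vectors form a basis and matrices can be used.
  rcases linearIndependent_krylov_or_exists_solution T hTinj (P r) k with hli | ⟨s, hs, hTs⟩
  swap
  · have hHs : H s = r := hP.injective hTs
    have h1 := h.2 s hs
    rw [hHs] at h1
    by_cases h0 : r - H d = 0
    · simp [h0]
    · have := hP.2 _ h0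
      simp only [sub_self, map_zero, inner_zero_left] at h1
      linarith
  rcases k with _ | k
  · have hd := h.1
    rw [krylovSubspace_eq_span_range] at hd
    have : d = 0 := by simpa using hd
    simp [this]
  set v : Fin (k + 1) → E := fun i => (T ^ (i : ℕ)) (P r) with hv
  have hvmem : ∀ i, v i ∈ krylovSubspace T (P r) (k + 1) := fun i =>
    Submodule.subset_span ⟨i, i.2, rfl⟩
  have hv0 : v 0 = P r := by simp [hv]
  have hvs : ∀ i : Fin k, v i.succ = P (H (v i.castSucc)) := fun i => by
    simp only [hv, Fin.val_succ, Fin.val_castSucc, pow_succ']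
    rfl
  obtain ⟨c, hc⟩ : ∃ c : Fin (k + 1) → ℝ, ∑ i, c i • v i = d := by
    have hd := h.1
    rw [krylovSubspace_eq_span_range] at hd
    exact (Submodule.mem_span_range_iff_exists_fun ℝ).1 hd
  -- `M` is the matrix, in the Krylov basis, of the map sending `v 0` to `d` and each `v (i+1)` back
  -- to `v i`. The equation `G * M = N` says that this map is the Galerkin compression of `T⁻¹`: on
  -- `v 0` it is residual orthogonality, on the others it is `T (v i) = v (i+1)`. The only nonzero
  -- diagonal entry `M` can have is `c 0`, so the sign of the trace is the sign of `c 0`.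
  set G : Matrix (Fin (k + 1)) (Fin (k + 1)) ℝ :=
    Matrix.of fun i j => inner ℝ (H (v i)) (P (H (v j))) with hG
  set N : Matrix (Fin (k + 1)) (Fin (k + 1)) ℝ :=
    Matrix.of fun i j => inner ℝ (H (v i)) (v j) with hN
  set M : Matrix (Fin (k + 1)) (Fin (k + 1)) ℝ :=
    Matrix.of fun i j => Fin.cases (c i) (fun j' => if i = j'.castSucc then 1 else 0) j with hM
  have hGpos : G.PosDef := by
    refine Matrix.PosDef.of_dotProduct_mulVec_pos ?_ fun x hx => ?_
    · ext i j
      simp only [hG, Matrix.conjTranspose_apply, Matrix.of_apply, star_trivial]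
      rw [← hP.1, real_inner_comm]
    · have hne : H (∑ i, x i • v i) ≠ 0 := fun h0 => by
        have h1 : ∑ i, x i • v i = 0 := hH.injective (by rw [h0, map_zero])
        exact hx (funext (Fintype.linearIndependent_iff.1 hli x h1))
      have := hP.2 _ hne
      refine this.trans_eq ?_
      simp only [dotProduct, Matrix.mulVec, hG, Matrix.of_apply, map_sum, map_smul, sum_inner,
        inner_sum, real_inner_smul_left, real_inner_smul_right, Finset.mul_sum, Pi.star_apply,
        star_trivial]
      rw [Finset.sum_comm]
      refine Finset.sum_congr rfl fun i _ => Finset.sum_congr rfl fun j _ => by ring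
  have hNpos : N.PosSemidef := by
    refine Matrix.PosSemidef.of_dotProduct_mulVec_nonneg ?_ fun x => ?_
    · ext i j
      simp only [hN, Matrix.conjTranspose_apply, Matrix.of_apply, star_trivial]
      rw [hH.1, real_inner_comm]
    · have := hH.inner_nonneg (∑ i, x i • v i)
      rw [← hH.1] at this
      refine this.trans_eq ?_
      simp only [dotProduct, Matrix.mulVec, hN, Matrix.of_apply, map_sum, map_smul, sum_inner,
        inner_sum, real_inner_smul_left, real_inner_smul_right, Finset.mul_sum, Pi.star_apply,
        star_trivial]
      rw [Finset.sum_comm]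
      refine Finset.sum_congr rfl fun i _ => Finset.sum_congr rfl fun j _ => by ring
  have hGM : G * M = N := by
    ext i j
    rw [Matrix.mul_apply]
    refine Fin.cases ?_ (fun j => ?_) j
    · have h1 := h.residual_orthogonal hP (hvmem i)
      rw [map_sub, inner_sub_right, ← hc] at h1
      simp only [hG, hN, hM, Matrix.of_apply, Fin.cases_zero, hv0]
      simp only [map_sum, map_smul, inner_sum, real_inner_smul_right] at h1
      rw [sub_eq_zero] at h1
      rw [h1]
      exact Finset.sum_congr rfl fun _ _ => mul_comm _ _
    · simp [hG, hN, hM, hvs]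
  have htr : M.trace = c 0 := by
    rw [Matrix.trace, Fin.sum_univ_succ]
    simp only [Matrix.diag_apply, hM, Matrix.of_apply, Fin.cases_zero, Fin.cases_succ]
    rw [Finset.sum_eq_zero, add_zero]
    intro i _
    rw [if_neg]
    exact fun h => absurd (congrArg Fin.val h) (by simp)
  have hc0 : 0 ≤ c 0 := htr ▸ Matrix.trace_nonneg_of_posDef_mul_eq hGpos hNpos hGM
  -- Every `v (i+1) = P (H (v i))` is orthogonal to the residual, so only the `v 0` term of `d`
  -- contributes.
  have key : inner ℝ d (r - H d) = c 0 * inner ℝ (r - H d) (P (r - H d)) := by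
    have h1 : ∀ i : Fin k, inner ℝ (v i.succ) (r - H d) = 0 := fun i => by
      rw [hvs, hP.1]
      exact h.residual_orthogonal hP (hvmem _)
    have h2 : inner ℝ (v 0) (r - H d) = inner ℝ (r - H d) (P (r - H d)) := by
      rw [hv0, hP.1]
      conv_rhs => rw [inner_sub_left, h.residual_orthogonal hP h.1, sub_zero]
    rw [← h2]
    nth_rewrite 1 [← hc]
    rw [sum_inner, Fin.sum_univ_succ]
    simp [real_inner_smul_left, h1]
  rw [key]
  exact mul_nonneg hc0 (hP.inner_nonneg _)

theorem IsExactOrKrylov.inner_map_self_le {H : E →L[ℝ] E} (hH : IsSPD H) {r d : E}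
    (h : IsExactOrKrylov H r d) : inner ℝ d (H d) ≤ inner ℝ r d := by
  rcases h with h | ⟨P, hP, k, h | h⟩
  · rw [h, real_inner_comm]
  · exact h.inner_map_self.le
  · have := h.inner_residual_nonneg hH hP
    rw [inner_sub_right, real_inner_comm] at this
    linarith

end Krylov

/-! ### The clamp onto an extended real interval -/

/-- The projection of `t` onto the (possibly unbounded) interval `[l, u]`. -/
noncomputable def ereClamp (l u : EReal) (t : ℝ) : ℝ := (max l (min u t)).toReal

section Clamp

variable {l u : EReal}

theorem coe_ereClamp (h : ∃ a : ℝ, l ≤ a ∧ (a : EReal) ≤ u) (t : ℝ) :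
    (ereClamp l u t : EReal) = max l (min u t) := by
  obtain ⟨a, hl, hu⟩ := h
  refine EReal.coe_toReal (ne_of_lt ?_) (ne_of_gt ?_)
  · exact max_lt (hl.trans_lt (EReal.coe_lt_top a))
      ((min_le_right _ _).trans_lt (EReal.coe_lt_top t))
  · exact lt_max_of_lt_right (lt_min ((EReal.bot_lt_coe a).trans_le hu) (EReal.bot_lt_coe t))

theorem ereClamp_mem (h : ∃ a : ℝ, l ≤ a ∧ (a : EReal) ≤ u) (t : ℝ) :
    l ≤ ereClamp l u t ∧ (ereClamp l u t : EReal) ≤ u := by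
  rw [coe_ereClamp h]
  obtain ⟨a, hl, hu⟩ := h
  exact ⟨le_max_left _ _, max_le (hl.trans hu) (min_le_left _ _)⟩

theorem ereClamp_of_mem {t : ℝ} (hl : l ≤ t) (hu : (t : EReal) ≤ u) : ereClamp l u t = t := by
  rw [ereClamp, min_eq_right hu, max_eq_right hl, EReal.toReal_coe]

theorem ereClamp_of_le {t : ℝ} (hl : (t : EReal) ≤ l) : ereClamp l u t = l.toReal := by
  rw [ereClamp, max_eq_left ((min_le_right _ _).trans hl)]

theorem ereClamp_of_ge (h : l ≤ u) {t : ℝ} (hu : u ≤ t) : ereClamp l u t = u.toReal := by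
  rw [ereClamp, min_eq_left hu, max_eq_right h]

/-- Variational inequality characterizing the projection onto an interval; an infinite bound is
never active. -/
theorem ereClamp_obtuse (h : ∃ a : ℝ, l ≤ a ∧ (a : EReal) ≤ u) (t : ℝ) {a : ℝ} (hl : l ≤ a)
    (hu : (a : EReal) ≤ u) : (t - ereClamp l u t) * (a - ereClamp l u t) ≤ 0 := by
  have hc := coe_ereClamp h t
  rcases le_total (t : EReal) l with h1 | h1
  · rw [max_eq_left ((min_le_right _ _).trans h1)] at hc
    rw [← hc, EReal.coe_le_coe_iff] at h1 hl
    exact mul_nonpos_of_nonpos_of_nonneg (by linarith) (by linarith)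
  rcases le_total (t : EReal) u with h2 | h2
  · simp [ereClamp_of_mem h1 h2]
  · rw [min_eq_left h2, max_eq_right (hl.trans hu)] at hc
    rw [← hc, EReal.coe_le_coe_iff] at h2 hu
    exact mul_nonpos_of_nonneg_of_nonpos (by linarith) (by linarith)

/-- Firm nonexpansiveness: each projected point is tested in the variational inequality of the
other, and the two are added. -/
theorem ereClamp_sq_le (h : ∃ a : ℝ, l ≤ a ∧ (a : EReal) ≤ u) (s t : ℝ) :
    (ereClamp l u s - ereClamp l u t) ^ 2 ≤ (ereClamp l u s - ereClamp l u t) * (s - t) := by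
  have h1 := ereClamp_obtuse h s (ereClamp_mem h t).1 (ereClamp_mem h t).2
  have h2 := ereClamp_obtuse h t (ereClamp_mem h s).1 (ereClamp_mem h s).2
  nlinarith

/-- Near a given point every other point lies in a linear piece of the clamp whose closure contains
the given point. -/
theorem ereClamp_locally (h : ∃ a : ℝ, l ≤ a ∧ (a : EReal) ≤ u) (t₀ : ℝ) :
    ∀ᶠ t in 𝓝 t₀, t = t₀ ∨
      ((∀ᶠ s in 𝓝 t, ereClamp l u s = s) ∧ ereClamp l u t₀ = t₀) ∨
      ((∀ᶠ s in 𝓝 t, ereClamp l u s = ereClamp l u t) ∧ ereClamp l u t = ereClamp l u t₀) := by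
  have hlu : l ≤ u := by
    obtain ⟨a, hl, hu⟩ := h
    exact hl.trans hu
  have hlt : ∀ {t : ℝ} {b : EReal}, (t : EReal) < b → ∀ᶠ s : ℝ in 𝓝 t, (s : EReal) < b :=
    fun ht => continuous_coe_real_ereal.continuousAt.eventually_lt continuousAt_const ht
  have hgt : ∀ {t : ℝ} {b : EReal}, b < (t : EReal) → ∀ᶠ s : ℝ in 𝓝 t, b < (s : EReal) :=
    fun ht => continuousAt_const.eventually_lt continuous_coe_real_ereal.continuousAt ht
  have low : ∀ {t : ℝ}, (t : EReal) < l → ∀ᶠ s in 𝓝 t, ereClamp l u s = ereClamp l u t :=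
    fun ht => (hlt ht).mono fun s hs => by rw [ereClamp_of_le hs.le, ereClamp_of_le ht.le]
  have high : ∀ {t : ℝ}, u < (t : EReal) → ∀ᶠ s in 𝓝 t, ereClamp l u s = ereClamp l u t :=
    fun ht => (hgt ht).mono fun s hs => by
      rw [ereClamp_of_ge hlu hs.le, ereClamp_of_ge hlu ht.le]
  have mid : ∀ {t : ℝ}, l < (t : EReal) → (t : EReal) < u → ∀ᶠ s in 𝓝 t, ereClamp l u s = s :=
    fun h1 h2 => by
      filter_upwards [hgt h1, hlt h2] with s hs1 hs2 using ereClamp_of_mem hs1.le hs2.le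
  have lower : ∀ᶠ t : ℝ in 𝓝 t₀, (t : EReal) < l → (t₀ : EReal) ≤ l := by
    rcases le_or_gt (t₀ : EReal) l with h1 | h1
    · exact Eventually.of_forall fun _ _ => h1
    · exact (hgt h1).mono fun t ht ht' => absurd ht' ht.le.not_gt
  have upper : ∀ᶠ t : ℝ in 𝓝 t₀, u < (t : EReal) → u ≤ (t₀ : EReal) := by
    rcases le_or_gt u (t₀ : EReal) with h1 | h1
    · exact Eventually.of_forall fun _ _ => h1
    · exact (hlt h1).mono fun t ht ht' => absurd ht' ht.le.not_gt
  have inner_low : ∀ᶠ t : ℝ in 𝓝 t₀, l ≤ (t : EReal) → l ≤ (t₀ : EReal) := by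
    rcases le_or_gt l (t₀ : EReal) with h1 | h1
    · exact Eventually.of_forall fun _ _ => h1
    · exact (hlt h1).mono fun t ht ht' => absurd ht ht'.not_gt
  have inner_high : ∀ᶠ t : ℝ in 𝓝 t₀, (t : EReal) ≤ u → (t₀ : EReal) ≤ u := by
    rcases le_or_gt (t₀ : EReal) u with h1 | h1
    · exact Eventually.of_forall fun _ _ => h1
    · exact (hgt h1).mono fun t ht ht' => absurd ht ht'.not_gt
  -- The clamp may have a kink at an endpoint; close to `t₀` no endpoint other than `t₀` itself can
  -- occur.
  have edge_low : ∀ᶠ t : ℝ in 𝓝 t₀, (t : EReal) = l → t = t₀ := by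
    by_cases h1 : (t₀ : EReal) = l
    · exact Eventually.of_forall fun t ht => EReal.coe_injective (ht.trans h1.symm)
    · rcases lt_or_gt_of_ne h1 with h1 | h1
      · exact (hlt h1).mono fun t ht ht' => absurd ht' ht.ne
      · exact (hgt h1).mono fun t ht ht' => absurd ht' ht.ne'
  have edge_high : ∀ᶠ t : ℝ in 𝓝 t₀, (t : EReal) = u → t = t₀ := by
    by_cases h1 : (t₀ : EReal) = u
    · exact Eventually.of_forall fun t ht => EReal.coe_injective (ht.trans h1.symm)
    · rcases lt_or_gt_of_ne h1 with h1 | h1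
      · exact (hlt h1).mono fun t ht ht' => absurd ht' ht.ne
      · exact (hgt h1).mono fun t ht ht' => absurd ht' ht.ne'
  filter_upwards [lower, upper, inner_low, inner_high, edge_low, edge_high]
    with t h1 h2 h3 h4 h5 h6
  rcases lt_trichotomy (t : EReal) l with hl | hl | hl
  · refine Or.inr (Or.inr ⟨low hl, ?_⟩)
    rw [ereClamp_of_le hl.le, ereClamp_of_le (h1 hl)]
  · exact Or.inl (h5 hl)
  rcases lt_trichotomy (t : EReal) u with hu | hu | hu
  · exact Or.inr (Or.inl ⟨mid hl hu, ereClamp_of_mem (h3 hl.le) (h4 hu.le)⟩)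
  · exact Or.inl (h6 hu)
  · refine Or.inr (Or.inr ⟨high hu, ?_⟩)
    rw [ereClamp_of_ge hlu hu.le, ereClamp_of_ge hlu (h2 hu)]

end Clamp

/-! ### Generalized slopes of the clamp -/

/-- `u` is an admissible generalized slope at `t` of a monotone nonexpansive function `p`. -/
def IsProjSlope (p : ℝ → ℝ) (t u : ℝ) : Prop :=
  u ∈ Set.Icc (0 : ℝ) 1 ∧ ((∀ᶠ s in 𝓝 t, p s = s) → u = 1) ∧
    ((∀ᶠ s in 𝓝 t, p s = p t) → u = 0)

/-- Firm nonexpansiveness puts every difference quotient `q` in `[0, 1]`, since it says `q² ≤ q`. -/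
theorem IsProjSlope.of_hasDerivAt {p : ℝ → ℝ} (hp : ∀ s t, (p s - p t) ^ 2 ≤ (p s - p t) * (s - t))
    {t u : ℝ} (h : HasDerivAt p u t) : IsProjSlope p t u := by
  refine ⟨?_, fun h1 => ?_, fun h1 => ?_⟩
  · refine isClosed_Icc.mem_of_tendsto h.tendsto_slope ?_
    filter_upwards [self_mem_nhdsWithin] with s hs
    have hne : s - t ≠ 0 := sub_ne_zero.2 hs
    have h1 := hp s t
    have h2 : slope p t s ^ 2 ≤ slope p t s := by
      rw [slope_def_field, div_pow, div_le_iff₀ (by positivity)]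
      calc (p s - p t) ^ 2 ≤ (p s - p t) * (s - t) := h1
        _ = _ := by field_simp
    constructor <;> nlinarith
  · exact h.unique ((hasDerivAt_id t).congr_of_eventuallyEq h1)
  · exact h.unique ((hasDerivAt_const t (p t)).congr_of_eventuallyEq h1)

/-- On an identity piece the distances to the interval vanish at both points; on a constant piece
the increment of the clamp vanishes. The first conclusion gives exactness of the Newton equation,
the second that of the trapezoidal rule. -/
theorem IsProjSlope.exact_of_ereClamp {l u : EReal} (h : ∃ a : ℝ, l ≤ a ∧ (a : EReal) ≤ u)
    (t₀ : ℝ) : ∀ᶠ t in 𝓝 t₀, (∀ v, IsProjSlope (ereClamp l u) t v →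
      ereClamp l u t - ereClamp l u t₀ = v * (t - t₀)) ∧
      (ereClamp l u t - ereClamp l u t₀) *
        ((t - ereClamp l u t) + (t₀ - ereClamp l u t₀)) = 0 := by
  filter_upwards [ereClamp_locally h t₀] with t ht
  rcases ht with rfl | ⟨h1, h2⟩ | ⟨h1, h2⟩
  · simp
  · refine ⟨fun v hv => ?_, ?_⟩
    · rw [hv.2.1 h1, h1.self_of_nhds, h2, one_mul]
    · rw [h1.self_of_nhds, h2]; ring
  · refine ⟨fun v hv => ?_, ?_⟩
    · rw [hv.2.2 h1, h2]; ring
    · rw [h2]; ring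

/-! ### The projector onto the box and its Clarke Jacobian -/

namespace PALData

variable {n m : ℕ} (D : PALData n m)

theorem isClosed_K : IsClosed D.K := by
  have : D.K = ⋂ i, ({x | D.l i ≤ ((x i : ℝ) : EReal)} ∩ {x | ((x i : ℝ) : EReal) ≤ D.u i}) := by
    ext x; simp [K]
  rw [this]
  refine isClosed_iInter fun i => ?_
  have hc : Continuous fun x : EuclideanSpace ℝ (Fin n) => ((x i : ℝ) : EReal) :=
    continuous_coe_real_ereal.comp (by fun_prop)
  exact (isClosed_le continuous_const hc).inter (isClosed_le hc continuous_const)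

variable {D}

theorem exists_mem_bounds (hK : D.K.Nonempty) (i : Fin n) :
    ∃ a : ℝ, D.l i ≤ a ∧ (a : EReal) ≤ D.u i := by
  obtain ⟨x, hx⟩ := hK
  exact ⟨x i, hx i⟩

theorem euclideanProj_K_apply (hK : D.K.Nonempty) (x : EuclideanSpace ℝ (Fin n)) (i : Fin n) :
    euclideanProj D.K x i = ereClamp (D.l i) (D.u i) (x i) := by
  obtain ⟨hp, hmin⟩ := euclideanProj_spec hK D.isClosed_K x
  set p := euclideanProj D.K x
  set q : EuclideanSpace ℝ (Fin n) :=
    WithLp.toLp 2 fun i => ereClamp (D.l i) (D.u i) (x i) with hq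
  have hqi : ∀ i, q i = ereClamp (D.l i) (D.u i) (x i) := fun i => rfl
  have h1 := hmin q fun i => by rw [hqi]; exact ereClamp_mem (exists_mem_bounds hK i) _
  have h2 : ‖x - p‖ ^ 2 ≤ ‖x - q‖ ^ 2 := by gcongr
  rw [EuclideanSpace.real_norm_sq_eq, EuclideanSpace.real_norm_sq_eq] at h2
  have h3 : ∀ i, (x i - q i) ^ 2 + (q i - p i) ^ 2 ≤ (x i - p i) ^ 2 := fun i => by
    have := ereClamp_obtuse (exists_mem_bounds hK i) (x i) (hp i).1 (hp i).2
    rw [← hqi] at this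
    nlinarith
  have h4 : ∑ i, (q i - p i) ^ 2 ≤ 0 := by
    have := Finset.sum_le_sum fun i (_ : i ∈ Finset.univ) => h3 i
    rw [Finset.sum_add_distrib] at this
    simp only [PiLp.sub_apply] at h2
    linarith
  have h5 := (Finset.sum_eq_zero_iff_of_nonneg fun i _ => sq_nonneg (q i - p i)).1
    (le_antisymm h4 (Finset.sum_nonneg fun i _ => sq_nonneg _)) i (Finset.mem_univ i)
  have h6 : q i - p i = 0 := by simpa using h5
  rw [← hqi]; linarith

/-- Elements of the Clarke Jacobian of the projector onto a box are diagonal, with admissible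
slopes on the diagonal. -/
theorem diagonal_of_mem_clarkeJacobian (hK : D.K.Nonempty) {x : EuclideanSpace ℝ (Fin n)}
    {U : EuclideanSpace ℝ (Fin n) →L[ℝ] EuclideanSpace ℝ (Fin n)}
    (hU : U ∈ clarkeJacobian (euclideanProj D.K) x) (i : Fin n) :
    IsProjSlope (ereClamp (D.l i) (D.u i)) (x i) (U (EuclideanSpace.single i 1) i) ∧
      ∀ v, U v i = U (EuclideanSpace.single i 1) i * v i := by
  set e : EuclideanSpace ℝ (Fin n) := EuclideanSpace.single i 1 with he
  have hei : e i = 1 := by simp [he]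
  have hcl := exists_mem_bounds hK i
  set p := ereClamp (D.l i) (D.u i) with hp
  have hderiv : ∀ z, DifferentiableAt ℝ (euclideanProj D.K) z →
      IsProjSlope p (z i) (fderiv ℝ (euclideanProj D.K) z e i) ∧
      ∀ v, fderiv ℝ (euclideanProj D.K) z v i = fderiv ℝ (euclideanProj D.K) z e i * v i := by
    intro z hz
    -- Coordinate `i` of the projector along the line `z + t v` depends on `v` only through `v i`,
    -- which forces the derivative to be diagonal.
    have hline : ∀ v : EuclideanSpace ℝ (Fin n),
        HasDerivAt (fun t : ℝ => p (z i + t * v i)) (fderiv ℝ (euclideanProj D.K) z v i) 0 := by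
      intro v
      have h1 : HasDerivAt (fun t : ℝ => z + t • v) v 0 := by
        simpa using ((hasDerivAt_id (0 : ℝ)).smul_const v).const_add z
      have h2 : HasFDerivAt (euclideanProj D.K) (fderiv ℝ (euclideanProj D.K) z)
          (z + (0 : ℝ) • v) := by simpa using hz.hasFDerivAt
      have h3 := h2.comp_hasDerivAt (0 : ℝ) h1
      have h4 := (EuclideanSpace.proj (𝕜 := ℝ) i).hasFDerivAt.comp_hasDerivAt (0 : ℝ) h3
      refine (h4.congr_of_eventuallyEq (Eventually.of_forall fun t => ?_))
      simp [euclideanProj_K_apply hK, hp]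
    have hpd : HasDerivAt p (fderiv ℝ (euclideanProj D.K) z e i) (z i) := by
      have h1 := hline e
      simp only [hei, mul_one] at h1
      have h2 : HasDerivAt (fun t : ℝ => t - z i) 1 (z i) := (hasDerivAt_id _).sub_const _
      have h3 := HasDerivAt.comp (z i) (h₂ := fun t : ℝ => p (z i + t)) (h := fun t => t - z i)
        (h₂' := fderiv ℝ (euclideanProj D.K) z e i) (by simpa using h1) h2
      simpa [Function.comp_def] using h3
    refine ⟨IsProjSlope.of_hasDerivAt (ereClamp_sq_le hcl) hpd, fun v => ?_⟩
    have h2 : HasDerivAt (fun t : ℝ => z i + t * v i) (v i) 0 := by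
      simpa using ((hasDerivAt_id (0 : ℝ)).mul_const (v i)).const_add (z i)
    have h3 := HasDerivAt.comp (0 : ℝ) (h₂ := p) (h := fun t => z i + t * v i)
      (h₂' := fderiv ℝ (euclideanProj D.K) z e i) (by simpa using hpd) h2
    exact (hline v).unique h3
  have hsub : clarkeJacobian (euclideanProj D.K) x ⊆
      {U | IsProjSlope p (x i) (U e i) ∧ ∀ v, U v i = U e i * v i} := by
    -- The target set is convex and contains all limits of derivatives: being locally the identity
    -- or locally constant is an open condition, so it passes from `x i` to the approximating
    -- points.
    refine convexHull_min ?_ ?_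
    · rintro V ⟨z, hzx, hzd, hV⟩
      have hVv : ∀ v, Tendsto (fun k => fderiv ℝ (euclideanProj D.K) (z k) v i) atTop
          (𝓝 (V v i)) := fun v => by
        have h1 : Continuous fun W : EuclideanSpace ℝ (Fin n) →L[ℝ] EuclideanSpace ℝ (Fin n) =>
          W v i := by fun_prop
        exact (h1.tendsto V).comp hV
      have hzi : Tendsto (fun k => z k i) atTop (𝓝 (x i)) := by
        have h1 : Continuous fun w : EuclideanSpace ℝ (Fin n) => w i := by fun_prop
        exact (h1.tendsto x).comp hzx
      refine ⟨⟨isClosed_Icc.mem_of_tendsto (hVv e)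
        (Eventually.of_forall fun k => (hderiv _ (hzd k)).1.1), fun h => ?_, fun h => ?_⟩,
        fun v => ?_⟩
      · refine tendsto_nhds_unique (hVv e) (tendsto_const_nhds.congr' ?_)
        filter_upwards [hzi.eventually h.eventually_nhds] with k hk
        exact ((hderiv _ (hzd k)).1.2.1 hk).symm
      · refine tendsto_nhds_unique (hVv e) (tendsto_const_nhds.congr' ?_)
        filter_upwards [hzi.eventually h.eventually_nhds] with k hk
        refine ((hderiv _ (hzd k)).1.2.2 ?_).symm
        filter_upwards [hk] with s hs
        rw [hs, hk.self_of_nhds]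
      · refine tendsto_nhds_unique (hVv v) (((hVv e).mul_const (v i)).congr fun k => ?_)
        exact ((hderiv _ (hzd k)).2 v).symm
    · rintro V ⟨⟨hV1, hV2, hV3⟩, hV4⟩ W ⟨⟨hW1, hW2, hW3⟩, hW4⟩ a b ha hb hab
      refine ⟨⟨?_, fun h => ?_, fun h => ?_⟩, fun v => ?_⟩
      · simpa using convex_Icc (0 : ℝ) 1 hV1 hW1 ha hb hab
      · simp [hV2 h, hW2 h, hab]
      · simp [hV3 h, hW3 h]
      · simp only [add_apply, smul_apply, PiLp.add_apply,
          PiLp.smul_apply, smul_eq_mul, hV4 v, hW4 v]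
        ring
  exact hsub hU

end PALData

/-! ### Convexity, gradient and generalized Hessians of `ψ` -/

namespace PALData

variable {n m : ℕ} (D : PALData n m)

theorem inner_A_left (x : EuclideanSpace ℝ (Fin n)) (y : EuclideanSpace ℝ (Fin m)) :
    inner ℝ (D.A x) y = inner ℝ x (D.At y) :=
  (ContinuousLinearMap.adjoint_inner_right D.A x y).symm

theorem norm_At_le (y : EuclideanSpace ℝ (Fin m)) : ‖D.At y‖ ≤ ‖D.A‖ * ‖y‖ := by
  have h := D.At.le_opNorm y
  rwa [At, LinearIsometryEquiv.norm_map] at h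

/-- The argument `xt + σ (A* y - c)` of the projector. -/
noncomputable def projArg (y : EuclideanSpace ℝ (Fin m)) : EuclideanSpace ℝ (Fin n) :=
  D.xt + D.σ • (D.At y - D.c)

/-- The maximizer `Π_K(xt + σ (A* y - c))` in the augmented Lagrangian. -/
noncomputable def primal (y : EuclideanSpace ℝ (Fin m)) : EuclideanSpace ℝ (Fin n) :=
  euclideanProj D.K (D.projArg y)

/-- The gradient `-b + A Π_K(xt + σ (A* y - c)) + τ σ⁻¹ (y - yt)` of `ψ`. -/
noncomputable def gradψ (y : EuclideanSpace ℝ (Fin m)) : EuclideanSpace ℝ (Fin m) :=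
  -D.b + D.A (D.primal y) + (D.τ * D.σ⁻¹) • (y - D.yt)

/-- The penalized Lagrangian whose supremum over `K` is the augmented Lagrangian at `xt`. -/
noncomputable def penLagrangian (y : EuclideanSpace ℝ (Fin m)) (s : EuclideanSpace ℝ (Fin n)) : ℝ :=
  D.lagrangian y s - 1 / (2 * D.σ) * ‖s - D.xt‖ ^ 2

theorem projArg_sub (y z : EuclideanSpace ℝ (Fin m)) :
    D.projArg y - D.projArg z = D.σ • D.At (y - z) := by
  simp only [projArg, map_sub]
  module

theorem penLagrangian_sub (y z : EuclideanSpace ℝ (Fin m)) (s : EuclideanSpace ℝ (Fin n)) :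
    D.penLagrangian z s - D.penLagrangian y s = inner ℝ (-D.b + D.A s) (z - y) := by
  rw [inner_add_left, inner_A_left]
  simp only [penLagrangian, lagrangian, map_sub, inner_sub_right, inner_neg_left]
  ring

variable {D}

/-- Completing the square in `s`. Maximizing over `K` thereby becomes projecting `projArg y` onto
`K`. -/
theorem penLagrangian_sub_same (hσ : 0 < D.σ) (y : EuclideanSpace ℝ (Fin m))
    (s s' : EuclideanSpace ℝ (Fin n)) :
    D.penLagrangian y s - D.penLagrangian y s'
      = 1 / (2 * D.σ) * (‖D.projArg y - s'‖ ^ 2 - ‖D.projArg y - s‖ ^ 2) := by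
  have h : ∀ s, D.penLagrangian y s = -inner ℝ D.b y - inner ℝ D.xt (D.c - D.At y)
      + D.σ / 2 * ‖D.At y - D.c‖ ^ 2 - 1 / (2 * D.σ) * ‖D.projArg y - s‖ ^ 2 := by
    intro s
    have h1 : D.projArg y - s = D.σ • (D.At y - D.c) - (s - D.xt) := by
      simp only [projArg]; abel
    have h2 : D.c - D.At y = -(D.At y - D.c) := by abel
    rw [penLagrangian, lagrangian, h1, h2]
    generalize D.At y - D.c = z
    rw [norm_sub_sq_real (D.σ • z), norm_smul, real_inner_smul_left, inner_sub_right,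
      inner_neg_right, inner_neg_right, real_inner_comm s z, real_inner_comm D.xt z, mul_pow, Real.norm_eq_abs,
      sq_abs]
    field_simp
    ring
  rw [h, h]
  ring

theorem augLagrangian_eq (hK : D.K.Nonempty) (hσ : 0 < D.σ) (y : EuclideanSpace ℝ (Fin m)) :
    D.augLagrangian y D.xt = D.penLagrangian y (D.primal y) := by
  obtain ⟨hp, hmin⟩ := euclideanProj_spec hK D.isClosed_K (D.projArg y)
  have : Nonempty D.K := hK.to_subtype
  refine le_antisymm (ciSup_le fun s => ?_)
    (le_ciSup (D.augLagrangian_bddAbove hσ y D.xt) (⟨D.primal y, hp⟩ : D.K))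
  have h1 := penLagrangian_sub_same hσ y (D.primal y) s
  have h2 : ‖D.projArg y - D.primal y‖ ^ 2 ≤ ‖D.projArg y - s‖ ^ 2 := by
    gcongr
    exact hmin s s.2
  have h3 : 0 ≤ 1 / (2 * D.σ) * (‖D.projArg y - s‖ ^ 2 - ‖D.projArg y - D.primal y‖ ^ 2) :=
    mul_nonneg (by positivity) (by linarith)
  change D.penLagrangian y s ≤ _
  linarith

theorem penLagrangian_le_augLagrangian (hσ : 0 < D.σ) (y : EuclideanSpace ℝ (Fin m))
    {s : EuclideanSpace ℝ (Fin n)} (hs : s ∈ D.K) :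
    D.penLagrangian y s ≤ D.augLagrangian y D.xt :=
  le_ciSup (D.augLagrangian_bddAbove hσ y D.xt) (⟨s, hs⟩ : D.K)

theorem primal_mem (hK : D.K.Nonempty) (y : EuclideanSpace ℝ (Fin m)) : D.primal y ∈ D.K :=
  (euclideanProj_spec hK D.isClosed_K (D.projArg y)).1

theorem primal_apply (hK : D.K.Nonempty) (y : EuclideanSpace ℝ (Fin m)) (i : Fin n) :
    D.primal y i = ereClamp (D.l i) (D.u i) (D.projArg y i) :=
  euclideanProj_K_apply hK _ i

theorem norm_primal_sub_le (hK : D.K.Nonempty) (hσ : 0 < D.σ) (y z : EuclideanSpace ℝ (Fin m)) :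
    ‖D.primal y - D.primal z‖ ≤ D.σ * (‖D.A‖ * ‖y - z‖) := by
  have h1 : ‖D.primal y - D.primal z‖ ≤ ‖D.projArg y - D.projArg z‖ := by
    refine le_of_sq_le_sq ?_ (norm_nonneg _)
    rw [EuclideanSpace.real_norm_sq_eq, EuclideanSpace.real_norm_sq_eq]
    refine Finset.sum_le_sum fun i _ => ?_
    have := ereClamp_sq_le (exists_mem_bounds hK i) (D.projArg y i) (D.projArg z i)
    simp only [PiLp.sub_apply, primal_apply hK]
    nlinarith
  refine h1.trans ?_
  rw [projArg_sub, norm_smul, Real.norm_of_nonneg hσ.le]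
  exact mul_le_mul_of_nonneg_left (D.norm_At_le _) hσ.le

theorem norm_gradψ_sub_le (hK : D.K.Nonempty) (hσ : 0 < D.σ) (hτ : 0 < D.τ)
    (y z : EuclideanSpace ℝ (Fin m)) :
    ‖D.gradψ y - D.gradψ z‖ ≤ (D.τ * D.σ⁻¹ + D.σ * ‖D.A‖ ^ 2) * ‖y - z‖ := by
  have h : D.gradψ y - D.gradψ z
      = (D.τ * D.σ⁻¹) • (y - z) + D.A (D.primal y - D.primal z) := by
    simp only [gradψ, map_sub]
    module
  rw [h]
  refine (norm_add_le _ _).trans ?_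
  rw [norm_smul, Real.norm_of_nonneg (by positivity)]
  have h1 := D.A.le_opNorm (D.primal y - D.primal z)
  have h2 := mul_le_mul_of_nonneg_left (norm_primal_sub_le hK hσ y z) (norm_nonneg D.A)
  linarith

theorem ψ_eq (hK : D.K.Nonempty) (hσ : 0 < D.σ) (y : EuclideanSpace ℝ (Fin m)) :
    D.ψ y = D.penLagrangian y (D.primal y) + D.τ * D.σ⁻¹ / 2 * ‖y - D.yt‖ ^ 2 := by
  rw [ψ, augLagrangian_eq hK hσ]
  congr 2
  field_simp

/-- The maximizer at `y` is a competitor at `z`, and for fixed `s` the penalized Lagrangian is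
affine in `y`; the quadratic term comes entirely from the proximal part. -/
theorem ψ_strongly_convex (hK : D.K.Nonempty) (hσ : 0 < D.σ) (y z : EuclideanSpace ℝ (Fin m)) :
    D.ψ y + inner ℝ (D.gradψ y) (z - y) + D.τ * D.σ⁻¹ / 2 * ‖z - y‖ ^ 2 ≤ D.ψ z := by
  have h1 := penLagrangian_le_augLagrangian hσ z (primal_mem hK y)
  rw [augLagrangian_eq hK hσ] at h1
  have h2 := D.penLagrangian_sub y z (D.primal y)
  have h3 : ‖z - D.yt‖ ^ 2 = ‖z - y‖ ^ 2 + 2 * inner ℝ (y - D.yt) (z - y) + ‖y - D.yt‖ ^ 2 := by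
    rw [show z - D.yt = (z - y) + (y - D.yt) by abel, norm_add_sq_real, real_inner_comm]
  rw [ψ_eq hK hσ, ψ_eq hK hσ, gradψ, inner_add_left, real_inner_smul_left, h3]
  linarith

/-- The lower bound with the two points exchanged, followed by the Lipschitz bound on `gradψ`. This
avoids integration and differentiability of `ψ`, at the price of a factor two in the constant. -/
theorem ψ_quadratic_upper (hK : D.K.Nonempty) (hσ : 0 < D.σ) (hτ : 0 < D.τ)
    (y z : EuclideanSpace ℝ (Fin m)) :
    D.ψ z ≤ D.ψ y + inner ℝ (D.gradψ y) (z - y)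
      + (D.τ * D.σ⁻¹ + D.σ * ‖D.A‖ ^ 2) * ‖z - y‖ ^ 2 := by
  have h1 := ψ_strongly_convex hK hσ z y
  have h2 : 0 ≤ D.τ * D.σ⁻¹ / 2 * ‖y - z‖ ^ 2 := by positivity
  have h3 := real_inner_le_norm (D.gradψ z - D.gradψ y) (z - y)
  have h4 := mul_le_mul_of_nonneg_right (norm_gradψ_sub_le hK hσ hτ z y) (norm_nonneg (z - y))
  have h5 : inner ℝ (D.gradψ z) (y - z) = -inner ℝ (D.gradψ z) (z - y) := by
    rw [← inner_neg_right, neg_sub]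
  rw [inner_sub_left] at h3
  nlinarith

/-- The lower and upper quadratic bounds squeeze the linearization error to order `‖z - y‖²`. -/
theorem hasGradientAt_ψ (hK : D.K.Nonempty) (hσ : 0 < D.σ) (hτ : 0 < D.τ)
    (y : EuclideanSpace ℝ (Fin m)) : HasGradientAt D.ψ (D.gradψ y) y := by
  rw [hasGradientAt_iff_isLittleO]
  have hbig : (fun z => D.ψ z - D.ψ y - inner ℝ (D.gradψ y) (z - y))
      =O[𝓝 y] fun z => ‖z - y‖ ^ 2 := by
    refine Asymptotics.IsBigO.of_bound (D.τ * D.σ⁻¹ + D.σ * ‖D.A‖ ^ 2)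
      (Eventually.of_forall fun z => ?_)
    have h1 := ψ_strongly_convex hK hσ y z
    have h2 := ψ_quadratic_upper hK hσ hτ y z
    have h3 : 0 ≤ D.τ * D.σ⁻¹ / 2 * ‖z - y‖ ^ 2 := by positivity
    have h4 : 0 ≤ (D.τ * D.σ⁻¹ + D.σ * ‖D.A‖ ^ 2) * ‖z - y‖ ^ 2 := by positivity
    rw [Real.norm_eq_abs, Real.norm_of_nonneg (by positivity), abs_le]
    constructor <;> linarith
  refine hbig.trans_isLittleO ?_
  have h := (Asymptotics.isLittleO_norm_pow_id (E' := EuclideanSpace ℝ (Fin m)) one_lt_two)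
    |>.comp_tendsto (k := fun z => z - y) (l' := 𝓝 y) (by
      have : Tendsto (fun z => z - y) (𝓝 y) (𝓝 (y - y)) :=
        (continuous_id.sub continuous_const).tendsto y
      simpa using this)
  exact h

theorem gradient_ψ (hK : D.K.Nonempty) (hσ : 0 < D.σ) (hτ : 0 < D.τ) : ∇ D.ψ = D.gradψ :=
  funext fun y => (hasGradientAt_ψ hK hσ hτ y).gradient

/-- Near any point `z` the gradient of `ψ` is reproduced exactly by every generalized Hessian, and
the trapezoidal rule for `ψ` on `[z, y]` is exact. -/
theorem exact_near (hK : D.K.Nonempty) (hσ : 0 < D.σ) (z : EuclideanSpace ℝ (Fin m)) :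
    ∀ᶠ y in 𝓝 z, (∀ U ∈ D.projJacobian y, D.genHessian U (y - z) = D.gradψ y - D.gradψ z) ∧
      D.ψ y - D.ψ z = 1 / 2 * inner ℝ (D.gradψ y + D.gradψ z) (y - z) := by
  have hcoord : ∀ᶠ y in 𝓝 z, ∀ i, _ := eventually_all.2 fun i => by
    have h1 : Continuous fun y => D.projArg y i := by unfold projArg; fun_prop
    exact (h1.tendsto z).eventually
      (IsProjSlope.exact_of_ereClamp (exists_mem_bounds hK i) (D.projArg z i))
  filter_upwards [hcoord] with y hy
  constructor
  · intro U hU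
    have hUp : U (D.projArg y - D.projArg z) = D.primal y - D.primal z := by
      ext i
      obtain ⟨hs, hd⟩ := diagonal_of_mem_clarkeJacobian hK hU i
      rw [hd, PiLp.sub_apply, PiLp.sub_apply, primal_apply hK, primal_apply hK,
        (hy i).1 _ hs]
    have h2 : D.gradψ y - D.gradψ z
        = (D.τ * D.σ⁻¹) • (y - z) + D.A (D.primal y - D.primal z) := by
      simp only [gradψ, map_sub]
      module
    rw [h2, ← hUp, projArg_sub]
    simp [genHessian]
  · have h1 := D.penLagrangian_sub z y (D.primal y)
    have h2 := penLagrangian_sub_same hσ z (D.primal y) (D.primal z)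
    -- Coordinatewise exactness of the clamp. Expanded, it replaces the difference of squared
    -- distances by an inner product that is linear in `y - z`, which yields the trapezoidal rule.
    have h3 : inner ℝ (D.primal y - D.primal z)
        ((D.projArg y - D.primal y) + (D.projArg z - D.primal z)) = 0 := by
      rw [PiLp.inner_apply]
      refine Finset.sum_eq_zero fun i _ => ?_
      simp only [PiLp.sub_apply, PiLp.add_apply, primal_apply hK, RCLike.inner_apply, conj_trivial]
      rw [mul_comm]
      exact (hy i).2
    have h4 : ‖D.projArg z - D.primal z‖ ^ 2 - ‖D.projArg z - D.primal y‖ ^ 2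
        = - inner ℝ (D.primal y - D.primal z) (D.projArg y - D.projArg z) := by
      have h5 : D.projArg z - D.primal y
          = (D.projArg z - D.primal z) - (D.primal y - D.primal z) := by abel
      have h6 : (D.projArg y - D.primal y) + (D.projArg z - D.primal z)
          = (D.projArg y - D.projArg z) + (2 : ℝ) • (D.projArg z - D.primal z)
            - (D.primal y - D.primal z) := by module
      rw [h6, inner_sub_right, inner_add_right, real_inner_smul_right,
        real_inner_self_eq_norm_sq] at h3
      rw [h5, norm_sub_sq_real (D.projArg z - D.primal z) (D.primal y - D.primal z),
        real_inner_comm]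
      linarith
    rw [h4, projArg_sub, real_inner_smul_right, ← inner_A_left, map_sub, inner_sub_left] at h2
    have h7 : D.penLagrangian z (D.primal y) - D.penLagrangian z (D.primal z)
        = - (1 / 2) * (inner ℝ (D.A (D.primal y)) (y - z) - inner ℝ (D.A (D.primal z)) (y - z)) := by
      rw [h2]; field_simp
    have h8 : ‖y - D.yt‖ ^ 2 - ‖z - D.yt‖ ^ 2
        = inner ℝ (y - D.yt) (y - z) + inner ℝ (z - D.yt) (y - z) := by
      rw [← inner_add_left, show y - z = (y - D.yt) - (z - D.yt) by abel, inner_sub_right,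
        inner_add_left, inner_add_left, real_inner_self_eq_norm_sq, real_inner_self_eq_norm_sq,
        real_inner_comm (y - D.yt)]
      ring
    rw [ψ_eq hK hσ, ψ_eq hK hσ, gradψ, gradψ]
    simp only [inner_add_left, real_inner_smul_left] at h1 ⊢
    linear_combination h1 + h7 + D.τ * D.σ⁻¹ / 2 * h8

theorem inner_proj_nonneg (hK : D.K.Nonempty) {y : EuclideanSpace ℝ (Fin m)}
    {U : EuclideanSpace ℝ (Fin n) →L[ℝ] EuclideanSpace ℝ (Fin n)} (hU : U ∈ D.projJacobian y)
    (v : EuclideanSpace ℝ (Fin n)) : 0 ≤ inner ℝ v (U v) := by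
  rw [PiLp.inner_apply]
  refine Finset.sum_nonneg fun i _ => ?_
  obtain ⟨hs, hd⟩ := diagonal_of_mem_clarkeJacobian hK hU i
  simp only [RCLike.inner_apply, conj_trivial]
  rw [hd, mul_assoc]
  exact mul_nonneg hs.1.1 (mul_self_nonneg _)

theorem norm_proj_le (hK : D.K.Nonempty) {y : EuclideanSpace ℝ (Fin m)}
    {U : EuclideanSpace ℝ (Fin n) →L[ℝ] EuclideanSpace ℝ (Fin n)} (hU : U ∈ D.projJacobian y)
    (v : EuclideanSpace ℝ (Fin n)) : ‖U v‖ ≤ ‖v‖ := by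
  refine le_of_sq_le_sq ?_ (norm_nonneg _)
  rw [EuclideanSpace.real_norm_sq_eq, EuclideanSpace.real_norm_sq_eq]
  refine Finset.sum_le_sum fun i _ => ?_
  obtain ⟨hs, hd⟩ := diagonal_of_mem_clarkeJacobian hK hU i
  rw [hd, mul_pow]
  exact mul_le_of_le_one_left (sq_nonneg _) (pow_le_one₀ hs.1.1 hs.1.2)

theorem inner_proj_comm (hK : D.K.Nonempty) {y : EuclideanSpace ℝ (Fin m)}
    {U : EuclideanSpace ℝ (Fin n) →L[ℝ] EuclideanSpace ℝ (Fin n)} (hU : U ∈ D.projJacobian y)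
    (v w : EuclideanSpace ℝ (Fin n)) : inner ℝ (U v) w = inner ℝ v (U w) := by
  rw [PiLp.inner_apply, PiLp.inner_apply]
  refine Finset.sum_congr rfl fun i _ => ?_
  have hd := (diagonal_of_mem_clarkeJacobian hK hU i).2
  simp only [RCLike.inner_apply, conj_trivial]
  rw [hd v, hd w]
  ring

theorem le_inner_genHessian (hK : D.K.Nonempty) (hσ : 0 < D.σ) {y : EuclideanSpace ℝ (Fin m)}
    {U : EuclideanSpace ℝ (Fin n) →L[ℝ] EuclideanSpace ℝ (Fin n)} (hU : U ∈ D.projJacobian y)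
    (v : EuclideanSpace ℝ (Fin m)) :
    D.τ * D.σ⁻¹ * ‖v‖ ^ 2 ≤ inner ℝ v (D.genHessian U v) := by
  have h1 := mul_nonneg hσ.le (inner_proj_nonneg hK hU (D.At v))
  simp only [genHessian, add_apply, smul_apply, ContinuousLinearMap.id_apply,
    ContinuousLinearMap.comp_apply, inner_add_right, real_inner_smul_right,
    real_inner_self_eq_norm_sq]
  rw [real_inner_comm (D.A _) v, inner_A_left, real_inner_comm]
  linarith

theorem norm_genHessian_le (hK : D.K.Nonempty) (hσ : 0 < D.σ) (hτ : 0 < D.τ)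
    {y : EuclideanSpace ℝ (Fin m)}
    {U : EuclideanSpace ℝ (Fin n) →L[ℝ] EuclideanSpace ℝ (Fin n)} (hU : U ∈ D.projJacobian y)
    (v : EuclideanSpace ℝ (Fin m)) :
    ‖D.genHessian U v‖ ≤ (D.τ * D.σ⁻¹ + D.σ * ‖D.A‖ ^ 2) * ‖v‖ := by
  simp only [genHessian, add_apply, smul_apply, ContinuousLinearMap.id_apply,
    ContinuousLinearMap.comp_apply]
  refine (norm_add_le _ _).trans ?_
  rw [norm_smul, norm_smul, Real.norm_of_nonneg (show 0 ≤ D.τ * D.σ⁻¹ by positivity),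
    Real.norm_of_nonneg hσ.le]
  have h1 : ‖D.A (U (D.At v))‖ ≤ ‖D.A‖ * (‖D.A‖ * ‖v‖) :=
    (D.A.le_opNorm _).trans (mul_le_mul_of_nonneg_left
      ((norm_proj_le hK hU _).trans (D.norm_At_le v)) (norm_nonneg _))
  have h2 := mul_le_mul_of_nonneg_left h1 hσ.le
  linarith

theorem isSPD_genHessian (hK : D.K.Nonempty) (hσ : 0 < D.σ) (hτ : 0 < D.τ)
    {y : EuclideanSpace ℝ (Fin m)}
    {U : EuclideanSpace ℝ (Fin n) →L[ℝ] EuclideanSpace ℝ (Fin n)} (hU : U ∈ D.projJacobian y) :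
    IsSPD (D.genHessian U) := by
  refine ⟨fun v w => ?_, fun v hv => ?_⟩
  · simp only [genHessian, add_apply, smul_apply, ContinuousLinearMap.id_apply,
      ContinuousLinearMap.comp_apply, inner_add_right, inner_add_left, real_inner_smul_right,
      real_inner_smul_left]
    rw [inner_A_left, real_inner_comm (D.A _) v, inner_A_left, inner_proj_comm hK hU,
      real_inner_comm (D.At v)]
  · have h1 := le_inner_genHessian hK hσ hU v
    have h2 : 0 < D.τ * D.σ⁻¹ * ‖v‖ ^ 2 := by positivity
    linarith

end PALData

/-! ### Inexact Newton method with Armijo backtracking -/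

/-- The inexactness criterion is a relative residual bound with a uniform factor below one. -/
theorem exists_forcing_factor {η γ : ℝ} (hη : η ∈ Set.Ioo (0 : ℝ) 1) (hγ : 0 < γ) :
    ∃ ρ : ℝ, ρ < 1 ∧ ∀ t : ℝ, 0 ≤ t → min η (t ^ (1 + γ)) ≤ ρ * t := by
  -- The crossover point of the two terms of the minimum, where `s ^ (1 + γ) = η`; the relative
  -- factor `s ^ γ` is attained there.
  set s : ℝ := η ^ (1 + γ)⁻¹ with hs
  have hs0 : 0 ≤ s := Real.rpow_nonneg hη.1.le _
  have hs1 : s < 1 := Real.rpow_lt_one hη.1.le hη.2 (by positivity)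
  have hsη : s ^ (1 + γ) = η := Real.rpow_inv_rpow hη.1.le (by positivity)
  refine ⟨s ^ γ, Real.rpow_lt_one hs0 hs1 hγ, fun t ht => ?_⟩
  rcases le_total s t with h | h
  · refine (min_le_left _ _).trans ?_
    rw [← hsη, Real.rpow_one_add' hs0 (by positivity), mul_comm]
    exact mul_le_mul_of_nonneg_left h (Real.rpow_nonneg hs0 _)
  · refine (min_le_right _ _).trans ?_
    rw [Real.rpow_one_add' ht (by positivity), mul_comm]
    exact mul_le_mul_of_nonneg_right (Real.rpow_le_rpow ht h hγ.le) ht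

section InexactNewton

variable {E : Type*} [NormedAddCommGroup E] [InnerProductSpace ℝ E]

/-- Lower bound for the step length found by Armijo backtracking. -/
theorem armijo_step_lower_bound {ψ : E → ℝ} {x d g : E} {κ L μ δ : ℝ} (hL : 0 < L)
    (hμ : μ < 1) (hδ : δ ∈ Set.Ioo (0 : ℝ) 1)
    (hup : ∀ z, ψ z ≤ ψ x + inner ℝ g (z - x) + L * ‖z - x‖ ^ 2)
    (hd : κ * ‖d‖ ^ 2 ≤ -inner ℝ g d) {k : ℕ}
    (hk : IsLeast {k : ℕ | ψ (x + δ ^ k • d) ≤ ψ x + μ * δ ^ k * inner ℝ g d} k) :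
    min 1 (δ * ((1 - μ) * κ / L)) ≤ δ ^ k := by
  rcases k with _ | k
  · simp
  refine (min_le_right _ _).trans ?_
  rw [pow_succ']
  refine mul_le_mul_of_nonneg_left ?_ hδ.1.le
  -- The previous trial step `δ ^ k` was rejected, which against the quadratic upper bound forces `δ
  -- ^ k` to be at least `(1 - μ) κ / L`.
  have h1 : ¬ ψ (x + δ ^ k • d) ≤ ψ x + μ * δ ^ k * inner ℝ g d := fun h =>
    absurd (hk.2 h) (by simp)
  have h2 := hup (x + δ ^ k • d)
  have ht : 0 < δ ^ k := pow_pos hδ.1 k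
  rw [add_sub_cancel_left, real_inner_smul_right, norm_smul, Real.norm_of_nonneg ht.le] at h2
  rw [div_le_iff₀ hL]
  by_contra hcon
  push Not at h1 hcon
  have h3 : δ ^ k * ((1 - μ) * (κ * ‖d‖ ^ 2)) ≤ δ ^ k * ((1 - μ) * -inner ℝ g d) := by
    have : 0 < 1 - μ := by linarith
    gcongr
  have h4 : δ ^ k * (δ ^ k * L * ‖d‖ ^ 2) ≤ δ ^ k * ((1 - μ) * κ * ‖d‖ ^ 2) := by gcongr
  nlinarith

/-- Convergence and local convergence rate of the inexact Newton method with Armijo backtracking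
for a strongly convex function with Lipschitz gradient `g`, when near the minimizer the Newton
equation and the trapezoidal rule are exact. -/
theorem inexact_newton_convergence {ψ : E → ℝ} {g : E → E} {κ L η γ μ δ : ℝ} (hκ : 0 < κ)
    (hL : 0 < L) (hη : η ∈ Set.Ioo (0 : ℝ) 1) (hγ : 0 < γ)
    (hμ : μ ∈ Set.Ioo (0 : ℝ) (1 / 2)) (hδ : δ ∈ Set.Ioo (0 : ℝ) 1)
    (hlow : ∀ x z, ψ x + inner ℝ (g x) (z - x) + κ / 2 * ‖z - x‖ ^ 2 ≤ ψ z)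
    (hup : ∀ x z, ψ z ≤ ψ x + inner ℝ (g x) (z - x) + L * ‖z - x‖ ^ 2)
    (hlip : ∀ x z, ‖g x - g z‖ ≤ L * ‖x - z‖)
    {ybar : E} (hg : g ybar = 0)
    {y d : ℕ → E} {H : ℕ → E →L[ℝ] E} {k : ℕ → ℕ}
    (hHlow : ∀ j v, κ * ‖v‖ ^ 2 ≤ inner ℝ v (H j v)) (hHup : ∀ j v, ‖H j v‖ ≤ L * ‖v‖)
    (hd : ∀ j, inner ℝ (d j) (H j (d j)) ≤ -inner ℝ (g (y j)) (d j))
    (hres : ∀ j, ‖H j (d j) + g (y j)‖ ≤ min η (‖g (y j)‖ ^ (1 + γ)))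
    (hk : ∀ j, IsLeast {k : ℕ | ψ (y j + δ ^ k • d j)
      ≤ ψ (y j) + μ * δ ^ k * inner ℝ (g (y j)) (d j)} (k j))
    (hstep : ∀ j, y (j + 1) = y j + δ ^ k j • d j)
    (htrap : ∀ᶠ z in 𝓝 ybar, ψ z - ψ ybar = 1 / 2 * inner ℝ (g z) (z - ybar))
    (hexact : ∀ᶠ z in 𝓝 ybar, ∀ j, y j = z → H j (z - ybar) = g z) :
    Tendsto y atTop (𝓝 ybar) ∧
      (fun j => ‖y (j + 1) - ybar‖) =O[atTop] (fun j => ‖y j - ybar‖ ^ (1 + γ)) := by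
  have hdesc : ∀ j, κ * ‖d j‖ ^ 2 ≤ -inner ℝ (g (y j)) (d j) := fun j => (hHlow j _).trans (hd j)
  have hmono : ∀ x, κ * ‖x - ybar‖ ^ 2 ≤ inner ℝ (g x) (x - ybar) := fun x => by
    have h1 := hlow x ybar
    have h2 := hlow ybar x
    rw [hg, inner_zero_left] at h2
    rw [← neg_sub x ybar, inner_neg_right, norm_neg] at h1
    linarith
  have hgx : ∀ x, ‖g x‖ ≤ L * ‖x - ybar‖ := fun x => by simpa [hg] using hlip x ybar
  have herr : ∀ x, κ * ‖x - ybar‖ ≤ ‖g x‖ := fun x => by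
    rcases (norm_nonneg (x - ybar)).eq_or_lt with h | h
    · rw [← h, mul_zero]; exact norm_nonneg _
    · refine le_of_mul_le_mul_right ?_ h
      calc κ * ‖x - ybar‖ * ‖x - ybar‖ = κ * ‖x - ybar‖ ^ 2 := by ring
        _ ≤ _ := (hmono x).trans (real_inner_le_norm _ _)
  -- global convergence
  obtain ⟨ρ, hρ1, hρ⟩ := exists_forcing_factor hη hγ
  set a : ℝ := min 1 (δ * ((1 - μ) * κ / L)) with ha
  have ha0 : 0 < a := by
    have h1 : 0 < 1 - μ := by linarith [hμ.2]
    have h2 := hδ.1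
    exact lt_min one_pos (by positivity)
  have haδ : ∀ j, a ≤ δ ^ k j := fun j =>
    armijo_step_lower_bound hL (by linarith [hμ.2]) hδ (hup _) (hdesc j) (hk j)
  -- Since the residual is at most `ρ‖g‖`, `H d` has norm at least `(1 - ρ)‖g‖`.
  have hdg : ∀ j, (1 - ρ) / L * ‖g (y j)‖ ≤ ‖d j‖ := fun j => by
    have h1 := (hres j).trans (hρ _ (norm_nonneg _))
    have h2 := norm_sub_le (H j (d j) + g (y j)) (H j (d j))
    rw [add_sub_cancel_left] at h2
    have h3 := hHup j (d j)
    rw [div_mul_eq_mul_div, div_le_iff₀ hL]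
    linarith
  set c : ℝ := μ * a * κ * ((1 - ρ) / L) ^ 2 with hc
  have hc0 : 0 < c := by
    have h1 : 0 < 1 - ρ := by linarith
    have h2 := hμ.1
    positivity
  have hdecr : ∀ j, c * ‖g (y j)‖ ^ 2 ≤ ψ (y j) - ψ (y (j + 1)) := fun j => by
    have h1 : ψ (y (j + 1)) ≤ ψ (y j) + μ * δ ^ k j * inner ℝ (g (y j)) (d j) := by
      rw [hstep]; exact (hk j).1
    have hμ0 := hμ.1
    have h0 : 0 ≤ (1 - ρ) / L * ‖g (y j)‖ :=
      mul_nonneg (div_nonneg (by linarith) hL.le) (norm_nonneg _)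
    have h2 : ((1 - ρ) / L * ‖g (y j)‖) ^ 2 ≤ ‖d j‖ ^ 2 := by
      gcongr
      exact hdg j
    calc c * ‖g (y j)‖ ^ 2 = μ * a * (κ * ((1 - ρ) / L * ‖g (y j)‖) ^ 2) := by rw [hc]; ring
      _ ≤ μ * δ ^ k j * (κ * ‖d j‖ ^ 2) := by
          have := pow_pos hδ.1 (k j)
          gcongr
          exact haδ j
      _ ≤ μ * δ ^ k j * -inner ℝ (g (y j)) (d j) := by
          have := pow_pos hδ.1 (k j)
          gcongr
          exact hdesc j
      _ ≤ _ := by linarith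
  have hanti : Antitone fun j => ψ (y j) := antitone_nat_of_succ_le fun j => by
    have := hdecr j
    have h2 : 0 ≤ c * ‖g (y j)‖ ^ 2 := by positivity
    linarith
  have hbdd : BddBelow (Set.range fun j => ψ (y j)) := by
    refine ⟨ψ ybar, ?_⟩
    rintro _ ⟨j, rfl⟩
    have h1 := hlow ybar (y j)
    rw [hg, inner_zero_left] at h1
    have h2 : 0 ≤ κ / 2 * ‖y j - ybar‖ ^ 2 := by positivity
    change ψ ybar ≤ ψ (y j)
    linarith
  have hlim := tendsto_atTop_ciInf hanti hbdd
  have hdiff : Tendsto (fun j => ψ (y j) - ψ (y (j + 1))) atTop (𝓝 0) := by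
    simpa using hlim.sub (hlim.comp (tendsto_add_atTop_nat 1))
  have hsq : Tendsto (fun j => ‖y j - ybar‖ ^ 2) atTop (𝓝 0) := by
    have h1 : Tendsto (fun j => (ψ (y j) - ψ (y (j + 1))) / (c * κ ^ 2)) atTop (𝓝 0) := by
      simpa using hdiff.div_const (c * κ ^ 2)
    refine squeeze_zero (fun j => by positivity) (fun j => ?_) h1
    rw [le_div_iff₀ (by positivity)]
    refine le_trans ?_ (hdecr j)
    have h2 : (κ * ‖y j - ybar‖) ^ 2 ≤ ‖g (y j)‖ ^ 2 := by
      gcongr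
      exact herr _
    nlinarith
  have hconv : Tendsto y atTop (𝓝 ybar) := by
    rw [tendsto_iff_norm_sub_tendsto_zero]
    simpa using hsq.sqrt
  refine ⟨hconv, ?_⟩
  -- local rate
  set C : ℝ := κ⁻¹ * L ^ (1 + γ) with hC
  have hC0 : 0 < C := by positivity
  have hnewton : ∀ᶠ j in atTop, ‖y j + d j - ybar‖ ≤ C * ‖y j - ybar‖ ^ (1 + γ) := by
    filter_upwards [hconv.eventually hexact] with j hj
    -- Exactness of the Newton equation: `H` applied to the new error is the residual of the linear
    -- system, with no linearization error.
    have h1 : H j (y j + d j - ybar) = H j (d j) + g (y j) := by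
      rw [← hj j rfl, ← map_add]
      congr 1
      abel
    have h2 : κ * ‖y j + d j - ybar‖ ≤ ‖H j (y j + d j - ybar)‖ := by
      generalize y j + d j - ybar = f
      rcases (norm_nonneg f).eq_or_lt with h | h
      · rw [← h, mul_zero]; exact norm_nonneg _
      · refine le_of_mul_le_mul_right ?_ h
        calc κ * ‖f‖ * ‖f‖ = κ * ‖f‖ ^ 2 := by ring
          _ ≤ inner ℝ f (H j f) := hHlow j f
          _ ≤ ‖f‖ * ‖H j f‖ := real_inner_le_norm _ _
          _ = _ := mul_comm _ _
    rw [h1] at h2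
    have h3 : ‖g (y j)‖ ^ (1 + γ) ≤ L ^ (1 + γ) * ‖y j - ybar‖ ^ (1 + γ) := by
      rw [← Real.mul_rpow hL.le (norm_nonneg _)]
      exact Real.rpow_le_rpow (norm_nonneg _) (hgx _) (by positivity)
    have h4 := h2.trans (((hres j).trans (min_le_right _ _)).trans h3)
    rw [hC, mul_assoc, le_inv_mul_iff₀ hκ]
    exact h4
  -- Contraction factor under which the full step passes the Armijo test. With `e` the current error
  -- norm, the slack `(1/2 - μ) κ e²` must absorb two terms of size at most `L θ e²`, hence the `2 *
  -- L`.
  set θ : ℝ := min 1 ((1 / 2 - μ) * κ / (2 * L)) with hθ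
  have hθ0 : 0 < θ := by
    have h1 : 0 < 1 / 2 - μ := by linarith [hμ.2]
    exact lt_min one_pos (by positivity)
  have hθ1 : θ ≤ 1 := min_le_left _ _
  have hθ2 : θ * (2 * L) ≤ (1 / 2 - μ) * κ := by
    rw [← le_div_iff₀ (by positivity)]
    exact min_le_right _ _
  have hsmall : ∀ᶠ j in atTop, C * ‖y j - ybar‖ ^ γ ≤ θ := by
    have h1 : Tendsto (fun j => C * ‖y j - ybar‖ ^ γ) atTop (𝓝 0) := by
      have h2 := (tendsto_iff_norm_sub_tendsto_zero.1 hconv).rpow_const (p := γ) (Or.inr hγ.le)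
      rw [Real.zero_rpow hγ.ne'] at h2
      simpa using h2.const_mul C
    exact (h1.eventually_lt_const hθ0).mono fun _ h => h.le
  refine Asymptotics.IsBigO.of_bound C ?_
  filter_upwards [hnewton, hsmall, hconv.eventually htrap] with j h1 h2 h3
  have hfe : ‖y j + d j - ybar‖ ≤ θ * ‖y j - ybar‖ := by
    refine h1.trans ?_
    rw [Real.rpow_one_add' (norm_nonneg _) (by positivity), mul_left_comm, mul_comm]
    exact mul_le_mul_of_nonneg_right h2 (norm_nonneg _)
  -- The trapezoidal rule gives `ψ (y j) - ψ ybar` exactly half of `⟨g, y j - ybar⟩`, while the test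
  -- asks for about `μ` times this; the value at the trial point exceeds the minimum by at most `L`
  -- times the squared new error.
  have haccept : ψ (y j + δ ^ 0 • d j) ≤ ψ (y j) + μ * δ ^ 0 * inner ℝ (g (y j)) (d j) := by
    rw [pow_zero, one_smul, mul_one]
    have h4 := hup ybar (y j + d j)
    rw [hg, inner_zero_left, add_zero] at h4
    have h5 : inner ℝ (g (y j)) (d j)
        = inner ℝ (g (y j)) (y j + d j - ybar) - inner ℝ (g (y j)) (y j - ybar) := by
      rw [← inner_sub_right]
      congr 1
      abel
    rw [h5]
    have h6 := hmono (y j)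
    have h7 := neg_le_of_abs_le (abs_real_inner_le_norm (g (y j)) (y j + d j - ybar))
    have h8 := hgx (y j)
    set e := ‖y j - ybar‖
    set f := ‖y j + d j - ybar‖
    have he : 0 ≤ e := norm_nonneg _
    have hf : 0 ≤ f := norm_nonneg _
    have hμ0 := hμ.1
    have h9 : ‖g (y j)‖ * f ≤ L * e * (θ * e) := by gcongr
    have h10 : L * f ^ 2 ≤ L * (θ * e ^ 2) := by
      gcongr
      calc f ^ 2 ≤ (θ * e) ^ 2 := by gcongr
        _ = θ * (θ * e ^ 2) := by ring
        _ ≤ 1 * (θ * e ^ 2) := by gcongr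
        _ = _ := one_mul _
    have h11 : (1 / 2 - μ) * (κ * e ^ 2) ≤ (1 / 2 - μ) * inner ℝ (g (y j)) (y j - ybar) :=
      mul_le_mul_of_nonneg_left h6 (by linarith [hμ.2])
    have h12 : θ * (2 * L) * e ^ 2 ≤ (1 / 2 - μ) * κ * e ^ 2 := by gcongr
    have h13 : μ * (L * e * (θ * e)) ≤ 1 * (L * e * (θ * e)) := by
      have : μ ≤ 1 := by linarith [hμ.2]
      gcongr
    have h14 : μ * -(L * e * (θ * e)) ≤ μ * inner ℝ (g (y j)) (y j + d j - ybar) :=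
      mul_le_mul_of_nonneg_left (by linarith) hμ0.le
    nlinarith
  have hk0 : k j = 0 := Nat.le_zero.1 ((hk j).2 haccept)
  have hy1 : y (j + 1) = y j + d j := by rw [hstep, hk0, pow_zero, one_smul]
  rw [hy1, norm_norm, Real.norm_of_nonneg (by positivity)]
  exact h1

end InexactNewton

/-! ### Existence of the minimizer and conclusion -/

/-- Strong convexity at the origin bounds `ψ` below by a quadratic in `‖z‖` with positive leading
coefficient, so `ψ` is coercive. -/
theorem PALData.exists_isMinimizer_ψ {n m : ℕ} {D : PALData n m} (hK : D.K.Nonempty)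
    (hσ : 0 < D.σ) (hτ : 0 < D.τ) :
    ∃ ybar, ∀ z, D.ψ ybar ≤ D.ψ z := by
  have hcont : Continuous D.ψ := continuous_iff_continuousAt.2 fun y =>
    (hasGradientAt_ψ hK hσ hτ y).hasFDerivAt.continuousAt
  refine hcont.exists_forall_le ?_
  have hκ : 0 < D.τ * D.σ⁻¹ / 2 := by positivity
  have h1 : Tendsto (fun t : ℝ => t * (D.τ * D.σ⁻¹ / 2 * t - ‖D.gradψ 0‖) + D.ψ 0) atTop atTop :=
    tendsto_atTop_add_const_right _ _ (tendsto_id.atTop_mul_atTop₀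
      (tendsto_atTop_add_const_right _ _ (tendsto_id.const_mul_atTop hκ)))
  refine tendsto_atTop_mono (fun z => ?_) (h1.comp (tendsto_norm_cocompact_atTop))
  have h2 := ψ_strongly_convex hK hσ 0 z
  have h3 := neg_le_of_abs_le (abs_real_inner_le_norm (D.gradψ 0) z)
  rw [sub_zero] at h2
  simp only [Function.comp_apply]
  nlinarith

theorem mainTheorem6 {n m : ℕ} (D : PALData n m) (hK : D.K.Nonempty)
    (hσ : 0 < D.σ) (hτ : 0 < D.τ)
    (η γ μ δ : ℝ) (hη : η ∈ Set.Ioo (0 : ℝ) 1) (hγ : γ ∈ Set.Ioc (0 : ℝ) 1)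
    (hμ : μ ∈ Set.Ioo (0 : ℝ) (1 / 2)) (hδ : δ ∈ Set.Ioo (0 : ℝ) 1)
    (y : ℕ → EuclideanSpace ℝ (Fin m)) (hy : D.IsSsnSequence η γ μ δ y) :
    ∃ ybar : EuclideanSpace ℝ (Fin m),
      (∀ z, D.ψ ybar ≤ D.ψ z) ∧
      (∀ w, (∀ z, D.ψ w ≤ D.ψ z) → w = ybar) ∧
      Tendsto y atTop (𝓝 ybar) ∧
      (fun j => ‖y (j + 1) - ybar‖) =O[atTop] (fun j => ‖y j - ybar‖ ^ (1 + γ)) := by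
  obtain ⟨ybar, hmin⟩ := PALData.exists_isMinimizer_ψ hK hσ hτ
  have hκ : 0 < D.τ * D.σ⁻¹ := by positivity
  have hL : 0 < D.τ * D.σ⁻¹ + D.σ * ‖D.A‖ ^ 2 := by positivity
  have hg : D.gradψ ybar = 0 := by
    have h1 : IsLocalMin D.ψ ybar := Eventually.of_forall hmin
    have h2 := h1.hasFDerivAt_eq_zero (PALData.hasGradientAt_ψ hK hσ hτ ybar).hasFDerivAt
    simpa using h2
  refine ⟨ybar, hmin, fun w hw => ?_, ?_⟩
  · have h1 := PALData.ψ_strongly_convex hK hσ ybar w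
    rw [hg, inner_zero_left] at h1
    have h2 := hw ybar
    have h3 : ‖w - ybar‖ ^ 2 ≤ 0 := by
      by_contra h
      push Not at h
      have : 0 < D.τ * D.σ⁻¹ / 2 * ‖w - ybar‖ ^ 2 := by positivity
      linarith
    have h4 : ‖w - ybar‖ = 0 := pow_eq_zero_iff two_ne_zero |>.1 (le_antisymm h3 (sq_nonneg _))
    exact sub_eq_zero.1 (norm_eq_zero.1 h4)
  · obtain ⟨-, hy⟩ := hy
    rw [PALData.gradient_ψ hK hσ hτ] at hy
    choose U hU d k hd hres hk hstep using hy
    have hnear := PALData.exact_near hK hσ ybar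
    refine inexact_newton_convergence (ψ := D.ψ) (g := D.gradψ) (d := d) (k := k)
      (H := fun j => D.genHessian (U j)) hκ hL hη hγ.1 hμ hδ
      (PALData.ψ_strongly_convex hK hσ) (PALData.ψ_quadratic_upper hK hσ hτ)
      (PALData.norm_gradψ_sub_le hK hσ hτ) hg
      (fun j => PALData.le_inner_genHessian hK hσ (hU j))
      (fun j => PALData.norm_genHessian_le hK hσ hτ (hU j)) (fun j => ?_) hres hk hstep ?_ ?_
    · have := (hd j).inner_map_self_le (PALData.isSPD_genHessian hK hσ hτ (hU j))
      rwa [inner_neg_left] at this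
    · filter_upwards [hnear] with z hz
      rw [hz.2, hg, add_zero]
    · filter_upwards [hnear] with z hz
      rintro j rfl
      rw [hz.1 _ (hU j), hg, sub_zero]
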